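/- Let $\|\cdot\|$ be an arbitrary norm on $\mathbb{R}^m$ with dual norm $\|z\|_*=\sup_{\|\xi\|\le 1} z^\top\xi$, let $\langle a,b\rangle=a^\top b$, and let $\Xi=\{\xi\in\mathbb{R}^m: C\xi\le d\}$ for a real matrix $C$ and vector $d$ (boundedness of $\Xi$ is not required). Let $\hat\xi_1,\dots,\hat\xi_N\in\Xi$ with $N\ge 1$, let $\hat P_N=\frac1N\sum_{i=1}^N\delta_{\hat\xi_i}$, and let $\varepsilon\ge 0$. Let $\mathcal M(\Xi)$ be the set of probability distributions $P$ supported on $\Xi$ with $\mathbb{E}^P[\|\xi\|]<\infty$, let $$d_W(P_1,P_2)=\inf_{\Pi}\int\|\xi_1-\xi_2\|\,\Pi(d\xi_1,d\xi_2),$$ where $\Pi$ ranges over all joint distributions with marginals $P_1$ and $P_2$, and let $\mathbb{B}_\varepsilon(\hat P_N)=\{P\in\mathcal M(\Xi): d_W(\hat P_N,P)\le\varepsilon\}$. For a loss function $\ell:\mathbb{R}^m\to[-\infty,\infty]$, its worst-case expectation is $\sup_{P\in\mathbb{B}_\varepsilon(\hat P_N)}\mathbb{E}^P[\ell(\xi)]$,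 where $\mathbb{E}^P[\ell]=\mathbb{E}^P[\max\{\ell,0\}]+\mathbb{E}^P[\min\{\ell,0\}]$ with the convention $\infty-\infty=\infty$. Vector inequalities are meant componentwise, and all matrices and vectors are real and of compatible dimensions. (i) Let $\ell(\xi)=\inf_y\{\langle y,Q\xi\rangle: Wy\ge h\}$ and suppose that $\{y: Wy\ge h\}$ is nonempty and compact. Then the worst-case expectation of $\ell$ equals the optimal value of $$\begin{array}{cll}\inf\limits_{\lambda,s_i,\gamma_i,y_i} & \lambda\varepsilon+\frac1N\sum_{i=1}^N s_i\\ \text{s.t.} & \langle y_i,Q\hat\xi_i\rangle+\langle\gamma_i,d-C\hat\xi_i\rangle\le s_i & \forall i\le N\\ & Wy_i\ge h & \forall i\le N\\ & \|Q^\top y_i-C^\top\gamma_i\|_*\le\lambda & \forall i\le N\\ & \gamma_i\ge 0 & \forall i\le N.\end{array}$$ (ii) Let $\ell(\xi)=\inf_y\{\langle q,y\rangle: Wy\ge H\xi+h\}$ and suppose that the dual feasible set $\{\theta\ge 0: W^\top\theta=q\}$ is nonempty and compact with vertices (extreme points) $v_1,\dots,v_K$. Then the worst-case expectation of $\ell$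 equals the optimal value of $$\begin{array}{cll}\inf\limits_{\lambda,s_i,\gamma_{ik}} & \lambda\varepsilon+\frac1N\sum_{i=1}^N s_i\\ \text{s.t.} & \langle v_k,h\rangle+\langle H^\top v_k,\hat\xi_i\rangle+\langle\gamma_{ik},d-C\hat\xi_i\rangle\le s_i & \forall i\le N,\ k\le K\\ & \|C^\top\gamma_{ik}-H^\top v_k\|_*\le\lambda & \forall i\le N,\ k\le K\\ & \gamma_{ik}\ge 0 & \forall i\le N,\ k\le K.\end{array}$$ -/

import Mathlib

open MeasureTheory Matrix
open scoped ENNReal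

noncomputable section

namespace WassersteinDRO

/-- The dual `‖z‖_* = sup {⟨z, ξ⟩ : ‖ξ‖ ≤ 1}` of the norm `p` on `ℝ^m`. -/
def dualNorm {m : ℕ} (p : Seminorm ℝ (Fin m → ℝ)) (z : Fin m → ℝ) : ℝ :=
  sSup {r : ℝ | ∃ ξ : Fin m → ℝ, p ξ ≤ 1 ∧ r = z ⬝ᵥ ξ}

/-- The polyhedron `{ξ : C ξ ≤ d}`. -/
def polyhedron {m l : ℕ} (C : Matrix (Fin l) (Fin m) ℝ) (d : Fin l → ℝ) : Set (Fin m → ℝ) :=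
  {ξ | C *ᵥ ξ ≤ d}

/-- The probability distributions supported on `S` for which the norm has finite expectation. -/
def distributions {m : ℕ} (p : Seminorm ℝ (Fin m → ℝ)) (S : Set (Fin m → ℝ)) :
    Set (Measure (Fin m → ℝ)) :=
  {Q | IsProbabilityMeasure Q ∧ Q Sᶜ = 0 ∧ ∫⁻ ξ, ENNReal.ofReal (p ξ) ∂Q < ∞}

/-- The (type-1) Wasserstein distance with transportation cost `p (ξ₁ - ξ₂)`: the infimum of the
transportation cost over all joint distributions with the given marginals. -/
def wasserstein {m : ℕ} (p : Seminorm ℝ (Fin m → ℝ)) (Q₁ Q₂ : Measure (Fin m → ℝ)) : ℝ≥0∞ :=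
  ⨅ (P : Measure ((Fin m → ℝ) × (Fin m → ℝ)))
    (_ : P.map Prod.fst = Q₁ ∧ P.map Prod.snd = Q₂),
    ∫⁻ x, ENNReal.ofReal (p (x.1 - x.2)) ∂P

/-- The empirical distribution `(1/N) ∑ δ_{ξ̂ᵢ}`. -/
def empirical {m N : ℕ} (xi : Fin N → Fin m → ℝ) : Measure (Fin m → ℝ) :=
  (N : ℝ≥0∞)⁻¹ • ∑ i, Measure.dirac (xi i)

/-- The Wasserstein ball of radius `ε` around `P` in the set of distributions on `S`. -/
def wassersteinBall {m : ℕ} (p : Seminorm ℝ (Fin m → ℝ)) (S : Set (Fin m → ℝ))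
    (P : Measure (Fin m → ℝ)) (ε : ℝ) : Set (Measure (Fin m → ℝ)) :=
  {Q | Q ∈ distributions p S ∧ wasserstein p P Q ≤ ENNReal.ofReal ε}

open Classical in
/-- The expectation `E[max(f,0)] + E[min(f,0)]` of an extended-real function, with the convention
`∞ - ∞ = ∞` (in `EReal`, `⊤ - ⊤ = ⊥`, hence the case distinction). -/
def expectation {m : ℕ} (Q : Measure (Fin m → ℝ)) (f : (Fin m → ℝ) → EReal) : EReal :=
  if ∫⁻ ξ, (f ξ).toENNReal ∂Q = ∞ then ⊤
  else ((∫⁻ ξ, (f ξ).toENNReal ∂Q : ℝ≥0∞) : EReal) - ((∫⁻ ξ, (-f ξ).toENNReal ∂Q : ℝ≥0∞) : EReal)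

/-- The worst-case expectation of the loss `f` over the Wasserstein ball of radius `ε` around the
empirical distribution of the sample `xi`. -/
def worstCaseExpectation {m N : ℕ} (p : Seminorm ℝ (Fin m → ℝ)) (S : Set (Fin m → ℝ))
    (xi : Fin N → Fin m → ℝ) (ε : ℝ) (f : (Fin m → ℝ) → EReal) : EReal :=
  ⨆ Q ∈ wassersteinBall p S (empirical xi) ε, expectation Q f

/-- The recourse cost `inf_y {⟨y, Q ξ⟩ : W y ≥ h}` with objective uncertainty. -/
def recourseObjective {m n r : ℕ} (Q : Matrix (Fin n) (Fin m) ℝ) (W : Matrix (Fin r) (Fin n) ℝ)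
    (h : Fin r → ℝ) (ξ : Fin m → ℝ) : EReal :=
  ⨅ (y : Fin n → ℝ) (_ : h ≤ W *ᵥ y), ((y ⬝ᵥ (Q *ᵥ ξ) : ℝ) : EReal)

/-- The recourse cost `inf_y {⟨q, y⟩ : W y ≥ H ξ + h}` with right-hand side uncertainty. -/
def recourseRhs {m n r : ℕ} (q : Fin n → ℝ) (W : Matrix (Fin r) (Fin n) ℝ)
    (H : Matrix (Fin r) (Fin m) ℝ) (h : Fin r → ℝ) (ξ : Fin m → ℝ) : EReal :=
  ⨅ (y : Fin n → ℝ) (_ : H *ᵥ ξ + h ≤ W *ᵥ y), ((q ⬝ᵥ y : ℝ) : EReal)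

/-- The dual feasible set `{θ ≥ 0 : Wᵀ θ = q}`. -/
def dualFeasible {n r : ℕ} (q : Fin n → ℝ) (W : Matrix (Fin r) (Fin n) ℝ) : Set (Fin r → ℝ) :=
  {θ | 0 ≤ θ ∧ Wᵀ *ᵥ θ = q}

/-- The optimal value of the finite program for objective uncertainty, with variables
`lam`, `s i`, `γ i`, `y i`. -/
def objectiveProgram {m l N n r : ℕ} (p : Seminorm ℝ (Fin m → ℝ))
    (C : Matrix (Fin l) (Fin m) ℝ) (d : Fin l → ℝ) (xi : Fin N → Fin m → ℝ) (ε : ℝ)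
    (Q : Matrix (Fin n) (Fin m) ℝ) (W : Matrix (Fin r) (Fin n) ℝ) (h : Fin r → ℝ) : EReal :=
  ⨅ (lam : ℝ) (s : Fin N → ℝ) (γ : Fin N → Fin l → ℝ) (y : Fin N → Fin n → ℝ)
    (_ : ∀ i, y i ⬝ᵥ (Q *ᵥ xi i) + γ i ⬝ᵥ (d - C *ᵥ xi i) ≤ s i ∧
      h ≤ W *ᵥ y i ∧
      dualNorm p (Qᵀ *ᵥ y i - Cᵀ *ᵥ γ i) ≤ lam ∧
      0 ≤ γ i),
    ((lam * ε + 1 / (N : ℝ) * ∑ i, s i : ℝ) : EReal)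

/-- The optimal value of the finite program for right-hand side uncertainty, with variables
`lam`, `s i`, `γ i k`; the vectors `v k` are the vertices of the dual feasible set. -/
def rhsProgram {m l N r K : ℕ} (p : Seminorm ℝ (Fin m → ℝ))
    (C : Matrix (Fin l) (Fin m) ℝ) (d : Fin l → ℝ) (xi : Fin N → Fin m → ℝ) (ε : ℝ)
    (H : Matrix (Fin r) (Fin m) ℝ) (h : Fin r → ℝ) (v : Fin K → Fin r → ℝ) : EReal :=
  ⨅ (lam : ℝ) (s : Fin N → ℝ) (γ : Fin N → Fin K → Fin l → ℝ)
    (_ : ∀ i k, v k ⬝ᵥ h + (Hᵀ *ᵥ v k) ⬝ᵥ xi i + γ i k ⬝ᵥ (d - C *ᵥ xi i) ≤ s i ∧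
      dualNorm p (Cᵀ *ᵥ γ i k - Hᵀ *ᵥ v k) ≤ lam ∧
      0 ≤ γ i k),
    ((lam * ε + 1 / (N : ℝ) * ∑ i, s i : ℝ) : EReal)

end WassersteinDRO

end

/-! In both parts compactness makes the loss `f` real-valued and Lipschitz for `p`: in (i) it is a
minimum of linear functions with uniformly bounded gradients, in (ii), by LP duality, a maximum of
the affine functions given by the vertices. Hence `f` is integrable under every distribution in the
ball.

The core is Lagrangian duality for the transport budget: the worst-case expectation is the infimum
of `t * ε + (1/N) ∑ s i` over `t ≥ 0` and `s` with `f ξ ≤ s i + t * p (ξ - xi i)` on the polyhedron.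
Integrating this constraint against a nearly optimal coupling gives `worstCaseExpectation_le`.
Conversely, the attainable (cost, value) pairs form a convex set in the plane, so a supporting line
supplies `t` (`exists_dual_of_worstCaseExpectation_le`).

It remains to make the semi-infinite constraint finite. Hahn-Banach inserts an affine function
between `f - s i` and `t * p (· - xi i)`; its gradient has dual norm at most `t`, and Farkas' lemma
certifies its domination of `f - s i` on the polyhedron (`exists_concave_certificate`). In (ii) this
is done for each vertex separately (`exists_affine_certificate`). -/

namespace WassersteinDRO

/-! ### Farkas' lemma -/

/-- Farkas' lemma for finitely many linear functionals on a real vector space. -/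
theorem farkas_finset {ι V : Type*} [DecidableEq ι] [AddCommGroup V] [Module ℝ V] (s : Finset ι) :
    ∀ (a : ι → V →ₗ[ℝ] ℝ) (b : V →ₗ[ℝ] ℝ), (∀ x, (∀ j ∈ s, a j x ≤ 0) → b x ≤ 0) →
      ∃ γ : ι → ℝ, (∀ j, 0 ≤ γ j) ∧ b = ∑ j ∈ s, γ j • a j := by
  induction s using Finset.induction_on with
  | empty =>
    intro a b h
    refine ⟨0, fun _ => le_rfl, ?_⟩
    ext x
    have h₁ := h x (by simp)
    have h₂ := h (-x) (by simp)
    rw [map_neg] at h₂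
    simp only [Finset.sum_empty, LinearMap.zero_apply]
    linarith
  | insert k s hk ih =>
    intro a b h
    have hupd : ∀ (γ : ι → ℝ) (t : ℝ),
        ∑ j ∈ s, Function.update γ k t j • a j = ∑ j ∈ s, γ j • a j := fun γ t =>
      Finset.sum_congr rfl fun j hj => by
        rw [Function.update_of_ne (ne_of_mem_of_not_mem hj hk)]
    by_cases hb : ∀ x, (∀ j ∈ s, a j x ≤ 0) → b x ≤ 0
    · obtain ⟨γ, hγ, hs⟩ := ih a b hb
      refine ⟨Function.update γ k 0, fun j => ?_, ?_⟩
      · by_cases hj : j = k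
        · simp [hj]
        · simpa [hj] using hγ j
      · rw [Finset.sum_insert hk, hupd, Function.update_self, zero_smul, zero_add, hs]
    · push Not at hb
      obtain ⟨z, hz, hbz⟩ := hb
      have hkz : 0 < a k z := by
        by_contra hn
        have := h z (by
          intro j hj
          rcases Finset.mem_insert.1 hj with rfl | hj
          · linarith
          · exact hz j hj)
        linarith
      set w : V := (a k z)⁻¹ • z with hw
      have hkw : a k w = 1 := by simp [hw, hkz.ne']
      have hsw : ∀ j ∈ s, a j w ≤ 0 := fun j hj => by
        rw [hw, map_smul, smul_eq_mul]
        exact mul_nonpos_of_nonneg_of_nonpos (inv_nonneg.2 hkz.le) (hz j hj)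
      have hbw : 0 < b w := by
        rw [hw, map_smul, smul_eq_mul]
        exact mul_pos (inv_pos.2 hkz) hbz
      -- The induction hypothesis is applied after composing with the projection `x ↦ x - a k x • w`
      -- onto the kernel of `a k`, where the `k`-th constraint holds trivially.
      obtain ⟨γ, hγ, hs⟩ := ih (fun j => a j - a j w • a k) (b - b w • a k) (by
        intro x hx
        have := h (x - a k x • w) (by
          intro j hj
          rcases Finset.mem_insert.1 hj with rfl | hj
          · simp [hkw]
          · have := hx j hj
            simp only [LinearMap.sub_apply, LinearMap.smul_apply, smul_eq_mul, map_sub,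
              map_smul] at this ⊢
            linarith)
        simp only [LinearMap.sub_apply, LinearMap.smul_apply, smul_eq_mul, map_sub,
          map_smul] at this ⊢
        linarith)
      have hsum : ∑ j ∈ s, γ j * a j w ≤ 0 :=
        Finset.sum_nonpos fun j hj => mul_nonpos_of_nonneg_of_nonpos (hγ j) (hsw j hj)
      -- Undoing the projection puts this coefficient on `a k`; it is nonnegative because `b w > 0`
      -- and `a j w ≤ 0`.
      refine ⟨Function.update γ k (b w - ∑ j ∈ s, γ j * a j w), fun j => ?_, ?_⟩
      · by_cases hj : j = k
        · subst hj
          simp only [Function.update_self]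
          linarith
        · simpa [hj] using hγ j
      · ext x
        have hx := congrArg (fun g : V →ₗ[ℝ] ℝ => g x) hs
        rw [Finset.sum_insert hk, hupd]
        simp only [LinearMap.sub_apply, LinearMap.smul_apply, smul_eq_mul, LinearMap.sum_apply,
          mul_sub, Finset.sum_sub_distrib, LinearMap.add_apply, Function.update_self] at hx ⊢
        rw [sub_mul, Finset.sum_mul]
        simp only [mul_assoc]
        linarith

/-- The affine form of Farkas' lemma: a linear functional bounded by `δ` on a nonempty polyhedron
has a dual certificate for that bound. -/
theorem affine_farkas {ι V : Type*} [Fintype ι] [AddCommGroup V] [Module ℝ V]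
    (A : V →ₗ[ℝ] ι → ℝ) (b : ι → ℝ) (c : V →ₗ[ℝ] ℝ) (δ : ℝ) {x₀ : V} (hx₀ : A x₀ ≤ b)
    (h : ∀ x, A x ≤ b → c x ≤ δ) :
    ∃ γ : ι → ℝ, 0 ≤ γ ∧ (∀ x, c x = γ ⬝ᵥ A x) ∧ γ ⬝ᵥ b ≤ δ := by
  classical
  -- Homogenization: the cone `A x ≤ t • b`, `t ≥ 0`, with `none` encoding the sign of `t`.
  let a : Option ι → (V × ℝ) →ₗ[ℝ] ℝ := fun o => o.elim (-LinearMap.snd ℝ V ℝ)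
    (fun j => LinearMap.proj j ∘ₗ A ∘ₗ LinearMap.fst ℝ V ℝ - b j • LinearMap.snd ℝ V ℝ)
  obtain ⟨γ, hγ, hs⟩ := farkas_finset Finset.univ a
    (c ∘ₗ LinearMap.fst ℝ V ℝ - δ • LinearMap.snd ℝ V ℝ) (by
      rintro ⟨x, t⟩ hx
      have ht : 0 ≤ t := by simpa [a] using hx none (Finset.mem_univ _)
      have hj : ∀ j, A x j - b j * t ≤ 0 := fun j => by
        simpa [a] using hx (some j) (Finset.mem_univ _)
      simp only [LinearMap.sub_apply, LinearMap.comp_apply, LinearMap.fst_apply,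
        LinearMap.smul_apply, LinearMap.snd_apply, smul_eq_mul]
      rcases ht.eq_or_lt with rfl | ht
      -- At `t = 0` the vector `x` is a recession direction, so `c` would be unbounded along the ray
      -- from `x₀`.
      · by_contra! hc
        simp only [mul_zero, sub_zero] at hc hj
        obtain ⟨k, hk⟩ := exists_nat_gt ((δ - c x₀) / c x)
        rw [div_lt_iff₀ hc] at hk
        have := h (x₀ + (k : ℝ) • x) (fun j => by
          have := mul_nonpos_of_nonneg_of_nonpos k.cast_nonneg (hj j)
          have := hx₀ j
          simp only [map_add, map_smul, Pi.add_apply, Pi.smul_apply, smul_eq_mul]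
          linarith)
        simp only [map_add, map_smul, smul_eq_mul] at this
        linarith
      · have := h (t⁻¹ • x) (fun j => by
          simp only [map_smul, Pi.smul_apply, smul_eq_mul]
          rw [inv_mul_le_iff₀ ht]
          linarith [hj j])
        rw [map_smul, smul_eq_mul, inv_mul_le_iff₀ ht] at this
        linarith)
  refine ⟨fun j => γ (some j), fun j => hγ _, fun x => ?_, ?_⟩
  · have := congrArg (fun g : V × ℝ →ₗ[ℝ] ℝ => g (x, 0)) hs
    simpa [a, Fintype.sum_option, dotProduct] using this
  · have := congrArg (fun g : V × ℝ →ₗ[ℝ] ℝ => g (0, 1)) hs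
    simp [a, Fintype.sum_option, dotProduct] at this ⊢
    linarith [hγ none]

/-- The affine form of Farkas' lemma for systems of inequalities and equations. -/
theorem affine_farkas_eq {ι κ V : Type*} [Fintype ι] [Fintype κ] [AddCommGroup V] [Module ℝ V]
    (A : V →ₗ[ℝ] ι → ℝ) (b : ι → ℝ) (B : V →ₗ[ℝ] κ → ℝ) (b' : κ → ℝ) (c : V →ₗ[ℝ] ℝ) (δ : ℝ)
    {x₀ : V} (hx₀ : A x₀ ≤ b) (hx₀' : B x₀ = b') (h : ∀ x, A x ≤ b → B x = b' → c x ≤ δ) :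
    ∃ (γ : ι → ℝ) (μ : κ → ℝ), 0 ≤ γ ∧ (∀ x, c x = γ ⬝ᵥ A x + μ ⬝ᵥ B x) ∧
      γ ⬝ᵥ b + μ ⬝ᵥ b' ≤ δ := by
  let A' : V →ₗ[ℝ] (ι ⊕ (κ ⊕ κ)) → ℝ :=
    { toFun := fun x => Sum.elim (A x) (Sum.elim (B x) (-B x))
      map_add' := fun x y => by
        ext (j | j | j) <;> simp [add_comm]
      map_smul' := fun t x => by
        ext (j | j | j) <;> simp }
  have key : ∀ x, A' x ≤ Sum.elim b (Sum.elim b' (-b')) ↔ A x ≤ b ∧ B x = b' := by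
    intro x
    simp only [A', LinearMap.coe_mk, AddHom.coe_mk, Sum.elim_le_elim_iff, neg_le_neg_iff]
    exact and_congr Iff.rfl le_antisymm_iff.symm
  obtain ⟨γ, hγ, hs, hδ⟩ := affine_farkas A' (Sum.elim b (Sum.elim b' (-b'))) c δ
    ((key x₀).2 ⟨hx₀, hx₀'⟩) (fun x hx => h x ((key x).1 hx).1 ((key x).1 hx).2)
  refine ⟨fun j => γ (.inl j), fun k => γ (.inr (.inl k)) - γ (.inr (.inr k)), fun j => hγ _,
    fun x => ?_, ?_⟩
  · rw [hs x]
    simp [A', dotProduct, sub_mul, Finset.sum_sub_distrib]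
    ring
  · simp only [dotProduct, sub_mul, Finset.sum_sub_distrib, Fintype.sum_sum_type, Sum.elim_inl,
      Sum.elim_inr, Pi.neg_apply, mul_neg, Finset.sum_neg_distrib] at hδ ⊢
    linarith

/-! ### Norms on `ℝ^m`, the dual norm and separation -/

section

variable {m : ℕ} {p : Seminorm ℝ (Fin m → ℝ)}

theorem seminorm_continuous (p : Seminorm ℝ (Fin m → ℝ)) : Continuous p :=
  continuousOn_univ.1 (p.convexOn.continuousOn isOpen_univ)

theorem exists_mul_norm_le (hp : ∀ ξ, p ξ = 0 → ξ = 0) : ∃ c : ℝ, 0 < c ∧ ∀ ξ, c * ‖ξ‖ ≤ p ξ := by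
  -- The sphere is empty when `m = 0`.
  rcases (Metric.sphere (0 : Fin m → ℝ) 1).eq_empty_or_nonempty with he | hne
  · refine ⟨1, one_pos, fun ξ => ?_⟩
    rcases eq_or_ne ξ 0 with rfl | hξ
    · simp
    · have : ‖ξ‖⁻¹ • ξ ∈ Metric.sphere (0 : Fin m → ℝ) 1 := by
        simp [norm_smul, hξ]
      simp [he] at this
  · obtain ⟨z, hz, hmin⟩ := (isCompact_sphere (0 : Fin m → ℝ) 1).exists_isMinOn hne
      (seminorm_continuous p).continuousOn
    have hz0 : z ≠ 0 := by
      rintro rfl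
      simp at hz
    refine ⟨p z, (apply_nonneg p z).lt_of_ne fun h => hz0 (hp z h.symm), fun ξ => ?_⟩
    rcases eq_or_ne ξ 0 with rfl | hξ
    · simp
    · have hmem : ‖ξ‖⁻¹ • ξ ∈ Metric.sphere (0 : Fin m → ℝ) 1 := by
        simp [norm_smul, hξ]
      have h := isMinOn_iff.1 hmin _ hmem
      rw [map_smul_eq_mul, norm_inv, norm_norm, inv_mul_eq_div,
        le_div_iff₀ (norm_pos_iff.2 hξ)] at h
      exact h

theorem dotProduct_le_norm_mul_norm (a ξ : Fin m → ℝ) : a ⬝ᵥ ξ ≤ m * ‖a‖ * ‖ξ‖ := by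
  calc a ⬝ᵥ ξ ≤ ∑ _i : Fin m, ‖a‖ * ‖ξ‖ := Finset.sum_le_sum fun i _ => by
        refine (le_abs_self _).trans ?_
        rw [abs_mul]
        exact mul_le_mul (norm_le_pi_norm a i) (norm_le_pi_norm ξ i) (abs_nonneg _) (norm_nonneg _)
    _ = m * ‖a‖ * ‖ξ‖ := by simp [mul_assoc]

/-- The linear functionals in a compact set are uniformly bounded by a multiple of the norm. -/
theorem exists_dotProduct_le_mul (hp : ∀ ξ, p ξ = 0 → ξ = 0) {K : Set (Fin m → ℝ)}
    (hK : IsCompact K) : ∃ L : ℝ, 0 ≤ L ∧ ∀ a ∈ K, ∀ ξ, a ⬝ᵥ ξ ≤ L * p ξ := by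
  obtain ⟨c, hc, hcp⟩ := exists_mul_norm_le hp
  obtain ⟨R, hR⟩ := hK.isBounded.exists_norm_le
  refine ⟨m * max R 0 / c, by positivity, fun a ha ξ => ?_⟩
  calc a ⬝ᵥ ξ ≤ m * ‖a‖ * ‖ξ‖ := dotProduct_le_norm_mul_norm a ξ
    _ ≤ m * max R 0 * (p ξ / c) := by
        gcongr
        · exact (hR a ha).trans (le_max_left _ _)
        · rw [le_div_iff₀ hc, mul_comm]
          exact hcp ξ
    _ = m * max R 0 / c * p ξ := by ring

/-- A real `sSup` is meaningful only for bounded sets; definiteness of `p` gives the bound. The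
condition `0 ≤ t` comes from `ξ = 0`. -/
theorem dualNorm_le_iff (hp : ∀ ξ, p ξ = 0 → ξ = 0) {z : Fin m → ℝ} {t : ℝ} :
    dualNorm p z ≤ t ↔ 0 ≤ t ∧ ∀ ξ, z ⬝ᵥ ξ ≤ t * p ξ := by
  obtain ⟨L, hL, hLp⟩ := exists_dotProduct_le_mul hp (isCompact_singleton (x := z))
  have hbdd : BddAbove {r : ℝ | ∃ ξ : Fin m → ℝ, p ξ ≤ 1 ∧ r = z ⬝ᵥ ξ} := by
    refine ⟨L, ?_⟩
    rintro r ⟨ξ, hξ, rfl⟩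
    exact (hLp z rfl ξ).trans (mul_le_of_le_one_right hL hξ)
  constructor
  · intro h
    refine ⟨(le_csSup hbdd ⟨0, by simp, by simp⟩).trans h, fun ξ => ?_⟩
    rcases (apply_nonneg p ξ).eq_or_lt with h0 | h0
    · rw [hp ξ h0.symm]
      simp
    · have := (le_csSup hbdd ⟨(p ξ)⁻¹ • ξ, by
        rw [map_smul_eq_mul, norm_inv, Real.norm_of_nonneg h0.le, inv_mul_cancel₀ h0.ne'],
        rfl⟩).trans h
      rwa [dotProduct_smul, smul_eq_mul, inv_mul_eq_div, div_le_iff₀ h0] at this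
  · rintro ⟨ht, h⟩
    refine csSup_le ⟨_, 0, by simp, rfl⟩ ?_
    rintro r ⟨ξ, hξ, rfl⟩
    exact (h ξ).trans (mul_le_of_le_one_right ht hξ)

theorem continuousLinearMap_prod_apply (φ : (Fin m → ℝ) × ℝ →L[ℝ] ℝ) :
    ∃ (w : Fin m → ℝ) (τ : ℝ), ∀ ξ u, φ (ξ, u) = w ⬝ᵥ ξ + τ * u := by
  refine ⟨fun i => φ (Pi.single i 1, 0), φ (0, 1), fun ξ u => ?_⟩
  have h₁ : φ (ξ, u) = (φ.toLinearMap ∘ₗ LinearMap.inl ℝ _ ℝ) ξ + u * φ (0, 1) := by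
    rw [← smul_eq_mul u, ← map_smul]
    simp [← map_add]
  rw [h₁, LinearMap.pi_apply_eq_sum_univ, mul_comm u]
  congr 1
  refine Finset.sum_congr rfl fun i _ => ?_
  simp only [LinearMap.comp_apply, LinearMap.inl_apply, smul_eq_mul, mul_comm (ξ i)]
  have hi : (fun j => if i = j then (1 : ℝ) else 0) = Pi.single i 1 := by
    ext j
    simp [Pi.single_apply, eq_comm]
  rw [hi]
  rfl

/-- A concave function dominated on `S` by `t * p (· - x₀)` is separated from it by an affine
function. -/
theorem exists_affine_between {S : Set (Fin m → ℝ)} {F : (Fin m → ℝ) → ℝ} (hF : ConcaveOn ℝ S F)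
    {x₀ : Fin m → ℝ} (hx₀ : x₀ ∈ S) {t : ℝ} (ht : 0 ≤ t) (h : ∀ ξ ∈ S, F ξ ≤ t * p (ξ - x₀)) :
    ∃ (c : Fin m → ℝ) (e : ℝ), (∀ ξ ∈ S, F ξ ≤ c ⬝ᵥ ξ + e) ∧ c ⬝ᵥ x₀ + e ≤ 0 ∧
      ∀ ξ, c ⬝ᵥ ξ ≤ t * p ξ := by
  have hcont : Continuous fun ξ => t * p (ξ - x₀) :=
    continuous_const.mul ((seminorm_continuous p).comp (continuous_id.sub continuous_const))
  have hconv : ConvexOn ℝ Set.univ fun ξ => t * p (ξ - x₀) := by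
    refine ⟨convex_univ, fun x _ y _ a b ha hb hab => ?_⟩
    have hxy : a • x + b • y - x₀ = a • (x - x₀) + b • (y - x₀) := by
      rw [smul_sub, smul_sub, sub_add_sub_comm, ← add_smul, hab, one_smul]
    have := p.convexOn.2 (Set.mem_univ (x - x₀)) (Set.mem_univ (y - x₀)) ha hb hab
    simp only [hxy, smul_eq_mul] at this ⊢
    nlinarith
  -- The open strict epigraph of `t * p (· - x₀)` is separated from the hypograph of `F`.
  obtain ⟨φ, r, hs, hT⟩ := geometric_hahn_banach_open
    (s := {q : (Fin m → ℝ) × ℝ | q.1 ∈ Set.univ ∧ t * p (q.1 - x₀) < q.2})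
    (t := {q : (Fin m → ℝ) × ℝ | q.1 ∈ S ∧ q.2 ≤ F q.1})
    hconv.convex_strict_epigraph
    (by
      simp only [Set.mem_univ, true_and]
      exact isOpen_lt (hcont.comp continuous_fst) continuous_snd)
    hF.convex_hypograph
    (Set.disjoint_left.2 fun q hq hq' => (hq.2.trans_le (hq'.2.trans (h _ hq'.1))).false)
  obtain ⟨w, τ, hφ⟩ := continuousLinearMap_prod_apply φ
  have hs' : ∀ ξ u, t * p (ξ - x₀) < u → w ⬝ᵥ ξ + τ * u < r := fun ξ u hu => by
    rw [← hφ]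
    exact hs (ξ, u) ⟨Set.mem_univ _, hu⟩
  have hT' : ∀ ξ ∈ S, r ≤ w ⬝ᵥ ξ + τ * F ξ := fun ξ hξ => by
    rw [← hφ]
    exact hT (ξ, F ξ) ⟨hξ, le_rfl⟩
  have hF0 : F x₀ ≤ 0 := by simpa using h x₀ hx₀
  -- The hyperplane is not vertical, since both sets contain points above or below `x₀`; dividing by
  -- `-τ` turns it into a graph.
  have hτ : τ < 0 := by
    have h₁ := hs' x₀ 1 (by simp)
    have h₂ := hT' x₀ hx₀
    by_contra! hn
    nlinarith
  have hub : ∀ ξ, (-τ)⁻¹ * (w ⬝ᵥ ξ - r) ≤ t * p (ξ - x₀) := fun ξ => by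
    refine le_of_forall_gt_imp_ge_of_dense fun u hu => ?_
    rw [inv_mul_le_iff₀ (by linarith)]
    linarith [hs' ξ u hu]
  refine ⟨(-τ)⁻¹ • w, -((-τ)⁻¹ * r), fun ξ hξ => ?_, ?_, fun ξ => ?_⟩
  · rw [smul_dotProduct, smul_eq_mul, ← sub_eq_add_neg, ← mul_sub, inv_mul_eq_div,
      le_div_iff₀ (by linarith)]
    linarith [hT' ξ hξ]
  · have := hub x₀
    simp only [sub_self, map_zero, mul_zero] at this
    rw [smul_dotProduct, smul_eq_mul]
    linarith
  · rw [smul_dotProduct, smul_eq_mul]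
    -- Otherwise the affine minorant would outgrow `t * p (· - x₀)` along the ray `x₀ + k • ξ`.
    by_contra! hc
    obtain ⟨k, hk⟩ := exists_nat_gt ((-((-τ)⁻¹ * (w ⬝ᵥ x₀ - r))) / ((-τ)⁻¹ * w ⬝ᵥ ξ - t * p ξ))
    rw [div_lt_iff₀ (by linarith)] at hk
    have := hub (x₀ + (k : ℝ) • ξ)
    rw [add_sub_cancel_left, map_smul_eq_mul, Real.norm_natCast, dotProduct_add, dotProduct_smul,
      smul_eq_mul] at this
    linarith

end

/-! ### Expectations and weak duality for the Wasserstein ball -/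

section

variable {m N : ℕ} {p : Seminorm ℝ (Fin m → ℝ)} {S : Set (Fin m → ℝ)} {xi : Fin N → Fin m → ℝ}
  {ε L : ℝ} {f : (Fin m → ℝ) → ℝ}

/-- Both parts of an integrable function have finite integral, so the convention for `∞ - ∞` plays
no role. -/
theorem expectation_coe {Q : Measure (Fin m → ℝ)} (hf : Integrable f Q) :
    expectation Q (fun ξ => (f ξ : EReal)) = ((∫ ξ, f ξ ∂Q : ℝ) : EReal) := by
  have h₁ : ∫⁻ ξ, ENNReal.ofReal (f ξ) ∂Q ≠ ∞ := hf.lintegral_lt_top.ne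
  have h₂ : ∫⁻ ξ, ENNReal.ofReal (-f ξ) ∂Q ≠ ∞ := hf.neg.lintegral_lt_top.ne
  have e₁ : ∀ ξ, (f ξ : EReal).toENNReal = ENNReal.ofReal (f ξ) := fun ξ => by simp
  have e₂ : ∀ ξ, (-(f ξ : EReal)).toENNReal = ENNReal.ofReal (-f ξ) := fun ξ => by
    rw [← EReal.coe_neg]
    simp
  simp only [expectation, e₁, e₂]
  rw [if_neg h₁, integral_eq_lintegral_pos_part_sub_lintegral_neg_part hf, EReal.coe_sub,
    EReal.coe_ennreal_toReal h₁, EReal.coe_ennreal_toReal h₂]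

theorem continuous_of_sub_le (hf : ∀ ξ η, f ξ - f η ≤ L * p (ξ - η)) : Continuous f := by
  refine continuous_iff_continuousAt.2 fun x => tendsto_iff_norm_sub_tendsto_zero.2 ?_
  have hc : Continuous fun ξ => L * p (ξ - x) :=
    continuous_const.mul ((seminorm_continuous p).comp (continuous_id.sub continuous_const))
  refine squeeze_zero (fun _ => norm_nonneg _) (fun ξ => ?_)
    (by simpa using hc.tendsto x)
  rw [Real.norm_eq_abs, abs_le]
  have := hf x ξ
  rw [map_sub_rev] at this
  exact ⟨by linarith, hf ξ x⟩

theorem integrable_comp_of_sub_le {Ω : Type*} [MeasurableSpace Ω] {μ : Measure Ω}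
    [IsFiniteMeasure μ] {X : Ω → Fin m → ℝ} (hX : Measurable X)
    (hf : ∀ ξ η, f ξ - f η ≤ L * p (ξ - η)) (hp : Integrable (fun ω => p (X ω)) μ) :
    Integrable (fun ω => f (X ω)) μ := by
  refine ((integrable_const |f 0|).add (hp.const_mul L)).mono'
    ((continuous_of_sub_le hf).measurable.comp hX).aestronglyMeasurable
    (Filter.Eventually.of_forall fun ω => ?_)
  have h₁ := hf (X ω) 0
  have h₂ := hf 0 (X ω)
  rw [map_sub_rev] at h₂
  rw [sub_zero] at h₁ h₂
  simp only [Real.norm_eq_abs, Pi.add_apply]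
  rw [abs_le]
  constructor <;> linarith [le_abs_self (f 0), neg_abs_le (f 0)]

theorem integrable_of_mem_distributions {Q : Measure (Fin m → ℝ)} (hQ : Q ∈ distributions p S) :
    Integrable p Q :=
  (lintegral_ofReal_ne_top_iff_integrable (seminorm_continuous p).aestronglyMeasurable
    (Filter.Eventually.of_forall fun _ => apply_nonneg p _)).1 hQ.2.2.ne

theorem isProbabilityMeasure_empirical (hN : 1 ≤ N) : IsProbabilityMeasure (empirical xi) := by
  refine ⟨?_⟩
  simp only [empirical, Measure.smul_apply, Measure.coe_finsetSum, Finset.sum_apply,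
    measure_univ, Finset.sum_const, Finset.card_univ, Fintype.card_fin, smul_eq_mul, nsmul_eq_mul,
    mul_one]
  exact ENNReal.inv_mul_cancel (by positivity) (by simp)

/-- The integral against an average of Dirac measures is the average of the values. -/
theorem integral_average_dirac {Ω : Type*} [MeasurableSpace Ω] [MeasurableSingletonClass Ω]
    (x : Fin N → Ω) (g : Ω → ℝ) :
    ∫ ω, g ω ∂((N : ℝ≥0∞)⁻¹ • ∑ i, Measure.dirac (x i)) = 1 / (N : ℝ) * ∑ i, g (x i) := by
  rw [integral_smul_measure, integral_finsetSum_measure fun i _ => integrable_dirac (by simp)]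
  simp

theorem integrable_average_dirac {Ω : Type*} [MeasurableSpace Ω] [MeasurableSingletonClass Ω]
    (hN : 1 ≤ N) (x : Fin N → Ω) (g : Ω → ℝ) :
    Integrable g ((N : ℝ≥0∞)⁻¹ • ∑ i, Measure.dirac (x i)) :=
  (integrable_finsetSum_measure.2 fun i _ => integrable_dirac (by simp)).smul_measure
    (ENNReal.inv_ne_top.2 (by positivity))

theorem ae_average_dirac {Ω : Type*} [MeasurableSpace Ω] [MeasurableSingletonClass Ω]
    (x : Fin N → Ω) {P : Ω → Prop} (h : ∀ i, P (x i)) :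
    ∀ᵐ ω ∂((N : ℝ≥0∞)⁻¹ • ∑ i, Measure.dirac (x i)), P ω := by
  refine Measure.ae_smul_measure ?_ _
  rw [ae_iff]
  simp [h]

theorem map_average_dirac {Ω Ω' : Type*} [MeasurableSpace Ω] [MeasurableSpace Ω']
    (x : Fin N → Ω) {g : Ω → Ω'} (hg : Measurable g) :
    ((N : ℝ≥0∞)⁻¹ • ∑ i, Measure.dirac (x i)).map g
      = (N : ℝ≥0∞)⁻¹ • ∑ i, Measure.dirac (g (x i)) := by
  rw [Measure.map_smul, Measure.map_finset_sum hg.aemeasurable]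
  simp [Measure.map_dirac' hg]

/-- Couplings in `wasserstein` range over all measures; their total mass is fixed by the marginal.
-/
theorem isProbabilityMeasure_of_map_fst {Ω Ω' : Type*} [MeasurableSpace Ω] [MeasurableSpace Ω']
    {P : Measure (Ω × Ω')} {Q : Measure Ω} [IsProbabilityMeasure Q] (h : P.map Prod.fst = Q) :
    IsProbabilityMeasure P := by
  refine ⟨?_⟩
  rw [← Set.preimage_univ (f := Prod.fst), ← Measure.map_apply measurable_fst MeasurableSet.univ, h,
    measure_univ]

/-- Weak duality: a dual feasible pair `(t, s)` bounds the worst-case expectation. -/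
theorem worstCaseExpectation_le (hN : 1 ≤ N) (hf : ∀ ξ η, f ξ - f η ≤ L * p (ξ - η))
    (hε : 0 ≤ ε) {t : ℝ} (ht : 0 ≤ t) {s : Fin N → ℝ}
    (h : ∀ i, ∀ ξ ∈ S, f ξ ≤ s i + t * p (ξ - xi i)) :
    worstCaseExpectation p S xi ε (fun ξ => (f ξ : EReal))
      ≤ ((t * ε + 1 / (N : ℝ) * ∑ i, s i : ℝ) : EReal) := by
  refine iSup₂_le fun Q hQ => ?_
  have hQprob : IsProbabilityMeasure Q := hQ.1.1
  have hemp : IsProbabilityMeasure (empirical xi) := isProbabilityMeasure_empirical hN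
  rw [expectation_coe (f := f) (integrable_comp_of_sub_le measurable_id hf
    (integrable_of_mem_distributions hQ.1)), EReal.coe_le_coe_iff]
  -- The infimum over couplings need not be attained, so a coupling of cost below `ε + δ` is used.
  suffices hδ : ∀ δ > 0, ∫ ξ, f ξ ∂Q ≤ t * (ε + δ) + 1 / (N : ℝ) * ∑ i, s i by
    refine le_of_forall_pos_le_add fun η hη => ?_
    have h₁ := hδ (η / (t + 1)) (by positivity)
    have h₂ : t * (η / (t + 1)) ≤ η := by
      rw [mul_div_assoc', div_le_iff₀ (by positivity)]
      nlinarith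
    linarith
  intro δ hδ
  have hlt : wasserstein p (empirical xi) Q < ENNReal.ofReal (ε + δ) :=
    hQ.2.trans_lt ((ENNReal.ofReal_lt_ofReal_iff (by linarith)).2 (by linarith))
  simp only [wasserstein, iInf_lt_iff] at hlt
  obtain ⟨P, ⟨hP₁, hP₂⟩, hcost⟩ := hlt
  have hPprob : IsProbabilityMeasure P := isProbabilityMeasure_of_map_fst hP₁
  have hmeas : Continuous fun x : (Fin m → ℝ) × (Fin m → ℝ) => p (x.1 - x.2) :=
    (seminorm_continuous p).comp (continuous_fst.sub continuous_snd)
  have hnn : ∀ x : (Fin m → ℝ) × (Fin m → ℝ), 0 ≤ p (x.1 - x.2) := fun x => apply_nonneg p _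
  have hint : Integrable (fun x : (Fin m → ℝ) × (Fin m → ℝ) => p (x.1 - x.2)) P :=
    (lintegral_ofReal_ne_top_iff_integrable hmeas.aestronglyMeasurable
      (Filter.Eventually.of_forall hnn)).1 (hcost.trans ENNReal.ofReal_lt_top).ne
  have hcost' : ∫ x, p (x.1 - x.2) ∂P ≤ ε + δ := by
    rw [← ofReal_integral_eq_lintegral_ofReal hint (Filter.Eventually.of_forall hnn)] at hcost
    exact ((ENNReal.ofReal_lt_ofReal_iff (by linarith)).1 hcost).le
  -- Sample points may coincide, so `s` need not be a function of the point; the smallest `s j` at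
  -- each point is. Off the sample the empty infimum is `0`, whence measurability.
  let g : (Fin m → ℝ) → ℝ := fun x => ⨅ j : {j : Fin N // xi j = x}, s j
  have hgle : ∀ i, g (xi i) ≤ s i := fun i =>
    ciInf_le (Set.finite_range _).bddBelow (⟨i, rfl⟩ : {j : Fin N // xi j = xi i})
  have hfg : ∀ i, ∀ ξ ∈ S, f ξ ≤ g (xi i) + t * p (xi i - ξ) := fun i ξ hξ => by
    have : Nonempty {j : Fin N // xi j = xi i} := ⟨⟨i, rfl⟩⟩
    have : f ξ - t * p (xi i - ξ) ≤ g (xi i) := le_ciInf fun ⟨j, hj⟩ => by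
      have := h j ξ hξ
      rw [hj, map_sub_rev] at this
      linarith
    linarith
  have hgm : Measurable g := by
    refine measurable_zero.measurable_of_countable_ne
      ((Set.finite_range xi).countable.mono fun x hx => ?_)
    by_contra hx'
    have : IsEmpty {j : Fin N // xi j = x} := ⟨fun j => hx' ⟨j, j.2⟩⟩
    exact hx (by simp [g, Real.iInf_of_isEmpty])
  have hgint : Integrable (fun x : (Fin m → ℝ) × (Fin m → ℝ) => g x.1) P := by
    have : Integrable g (P.map Prod.fst) := by
      rw [hP₁]
      exact integrable_average_dirac hN xi g
    exact this.comp_measurable measurable_fst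
  have hgval : ∫ x, g x.1 ∂P = 1 / (N : ℝ) * ∑ i, g (xi i) := by
    rw [← integral_average_dirac xi g, ← empirical, ← hP₁,
      integral_map measurable_fst.aemeasurable hgm.aestronglyMeasurable]
  have hfc := continuous_of_sub_le hf
  have hfint : Integrable (fun x : (Fin m → ℝ) × (Fin m → ℝ) => f x.2) P := by
    have : Integrable f (P.map Prod.snd) := by
      rw [hP₂]
      exact integrable_comp_of_sub_le measurable_id hf (integrable_of_mem_distributions hQ.1)
    exact this.comp_measurable measurable_snd
  have hae₁ : ∀ᵐ x ∂P, x.1 ∈ Set.range xi := by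
    refine ae_of_ae_map (f := Prod.fst) (p := fun y => y ∈ Set.range xi)
      measurable_fst.aemeasurable ?_
    rw [hP₁]
    exact ae_average_dirac xi fun i => ⟨i, rfl⟩
  have hae₂ : ∀ᵐ x ∂P, x.2 ∈ S := by
    refine ae_of_ae_map (f := Prod.snd) (p := fun y => y ∈ S) measurable_snd.aemeasurable ?_
    rw [hP₂]
    exact hQ.1.2.1
  calc ∫ ξ, f ξ ∂Q = ∫ x, f x.2 ∂P := by
        rw [← hP₂, integral_map measurable_snd.aemeasurable hfc.aestronglyMeasurable]
    _ ≤ ∫ x, (g x.1 + t * p (x.1 - x.2)) ∂P := by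
        refine integral_mono_ae hfint (hgint.add (hint.const_mul t)) ?_
        filter_upwards [hae₁, hae₂] with x hx₁ hx₂
        obtain ⟨i, hi⟩ := hx₁
        rw [← hi]
        exact hfg i x.2 hx₂
    _ = 1 / (N : ℝ) * ∑ i, g (xi i) + t * ∫ x, p (x.1 - x.2) ∂P := by
        rw [integral_add hgint (hint.const_mul t), integral_const_mul, hgval]
    _ ≤ 1 / (N : ℝ) * ∑ i, s i + t * (ε + δ) := by
        gcongr with i
        exact hgle i
    _ = _ := add_comm _ _

/-! ### Strong duality for the Wasserstein ball -/

/-- The pairs (transportation cost, expected loss) attained by joint distributions of the sample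
and a distribution on `S`. -/
def attainable (p : Seminorm ℝ (Fin m → ℝ)) (S : Set (Fin m → ℝ)) (xi : Fin N → Fin m → ℝ)
    (f : (Fin m → ℝ) → ℝ) : Set (ℝ × ℝ) :=
  {z | ∃ P : Measure ((Fin m → ℝ) × (Fin m → ℝ)), P.map Prod.fst = empirical xi ∧
    (∀ᵐ x ∂P, x.2 ∈ S) ∧ Integrable (fun x => p x.2) P ∧ Integrable (fun x => f x.2) P ∧
    Integrable (fun x => p (x.1 - x.2)) P ∧
    ∫ x, p (x.1 - x.2) ∂P = z.1 ∧ ∫ x, f x.2 ∂P = z.2}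

/-- With the first marginal fixed, cost and value are linear in the coupling, so mixtures of
couplings realize convex combinations. -/
theorem convex_attainable : Convex ℝ (attainable p S xi f) := by
  rintro ⟨_, _⟩ ⟨P, hP, hS, hi₁, hi₂, hi₃, rfl, rfl⟩ ⟨_, _⟩ ⟨P', hP', hS', hi₁', hi₂', hi₃', rfl, rfl⟩
    a b ha hb hab
  have hab' : ENNReal.ofReal a + ENNReal.ofReal b = 1 := by
    rw [← ENNReal.ofReal_add ha hb, hab, ENNReal.ofReal_one]
  have hint : ∀ {g : (Fin m → ℝ) × (Fin m → ℝ) → ℝ}, Integrable g P → Integrable g P' →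
      Integrable g (ENNReal.ofReal a • P + ENNReal.ofReal b • P') := fun h h' =>
    (h.smul_measure ENNReal.ofReal_ne_top).add_measure (h'.smul_measure ENNReal.ofReal_ne_top)
  have hval : ∀ {g : (Fin m → ℝ) × (Fin m → ℝ) → ℝ}, Integrable g P → Integrable g P' →
      ∫ x, g x ∂(ENNReal.ofReal a • P + ENNReal.ofReal b • P')
        = a * ∫ x, g x ∂P + b * ∫ x, g x ∂P' := fun h h' => by
    rw [integral_add_measure (h.smul_measure ENNReal.ofReal_ne_top)
      (h'.smul_measure ENNReal.ofReal_ne_top), integral_smul_measure, integral_smul_measure,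
      ENNReal.toReal_ofReal ha, ENNReal.toReal_ofReal hb, smul_eq_mul, smul_eq_mul]
  refine ⟨ENNReal.ofReal a • P + ENNReal.ofReal b • P', ?_, ?_, hint hi₁ hi₁', hint hi₂ hi₂',
    hint hi₃ hi₃', hval hi₃ hi₃', hval hi₂ hi₂'⟩
  · rw [Measure.map_add _ _ measurable_fst, Measure.map_smul, Measure.map_smul, hP, hP', ← add_smul,
      hab', one_smul]
  · exact ae_add_measure_iff.2 ⟨Measure.ae_smul_measure hS _, Measure.ae_smul_measure hS' _⟩

/-- The coupling moves each `xi i` to `x i`; these discrete plans already determine the dual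
constraints. -/
theorem mem_attainable (hN : 1 ≤ N) {x : Fin N → Fin m → ℝ} (hx : ∀ i, x i ∈ S) :
    (1 / (N : ℝ) * ∑ i, p (x i - xi i), 1 / (N : ℝ) * ∑ i, f (x i)) ∈ attainable p S xi f := by
  refine ⟨(N : ℝ≥0∞)⁻¹ • ∑ i, Measure.dirac (xi i, x i), map_average_dirac _ measurable_fst,
    ae_average_dirac _ hx, integrable_average_dirac hN _ _, integrable_average_dirac hN _ _,
    integrable_average_dirac hN _ _, ?_, integral_average_dirac _ _⟩
  rw [integral_average_dirac _ fun x : (Fin m → ℝ) × (Fin m → ℝ) => p (x.1 - x.2)]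
  simp only [map_sub_rev]

theorem le_worstCaseExpectation_of_mem_attainable (hN : 1 ≤ N) {z : ℝ × ℝ}
    (hz : z ∈ attainable p S xi f) (hzε : z.1 ≤ ε) (hSm : MeasurableSet S)
    (hfc : Continuous f) :
    (z.2 : EReal) ≤ worstCaseExpectation p S xi ε (fun ξ => (f ξ : EReal)) := by
  obtain ⟨P, hP, hS, hi₁, hi₂, hi₃, hc, hv⟩ := hz
  have hemp : IsProbabilityMeasure (empirical xi) := isProbabilityMeasure_empirical hN
  have hPprob : IsProbabilityMeasure P := isProbabilityMeasure_of_map_fst hP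
  have hmem : P.map Prod.snd ∈ wassersteinBall p S (empirical xi) ε := by
    refine ⟨⟨Measure.isProbabilityMeasure_map measurable_snd.aemeasurable, ?_, ?_⟩, ?_⟩
    · exact (ae_map_iff measurable_snd.aemeasurable hSm).2 hS
    · rw [lintegral_map (seminorm_continuous p).measurable.ennreal_ofReal measurable_snd]
      exact hi₁.lintegral_lt_top
    · refine (iInf₂_le P ⟨hP, rfl⟩).trans ?_
      rw [← ofReal_integral_eq_lintegral_ofReal hi₃
        (Filter.Eventually.of_forall fun x => apply_nonneg p _), hc]
      exact ENNReal.ofReal_le_ofReal hzε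
  refine le_trans (le_of_eq ?_) (le_iSup₂ (f := fun Q _ => expectation Q _) _ hmem)
  rw [expectation_coe ((integrable_map_measure hfc.aestronglyMeasurable
    measurable_snd.aemeasurable).2 hi₂), integral_map measurable_snd.aemeasurable
    hfc.aestronglyMeasurable, hv]

/-- A Lagrange multiplier for a convex set of (cost, value) pairs whose value is at most `M`
whenever the cost is at most `ε`. -/
theorem exists_multiplier {A : Set (ℝ × ℝ)} (hA : Convex ℝ A) {M : ℝ}
    (hM : ∀ z ∈ A, z.1 ≤ ε → z.2 ≤ M) {z₀ : ℝ × ℝ} (hz₀ : z₀ ∈ A) (hz₀ε : z₀.1 < ε) :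
    ∃ t : ℝ, 0 ≤ t ∧ ∀ z ∈ A, z.2 ≤ M + t * (z.1 - ε) := by
  -- The segment from `z` to `z'` crosses cost `ε` at a value at most `M`, so slopes from `(ε, M)`
  -- to points on the right do not exceed those to points on the left.
  have key : ∀ z ∈ A, z.1 < ε → ∀ z' ∈ A, ε < z'.1 →
      (z'.2 - M) / (z'.1 - ε) ≤ (M - z.2) / (ε - z.1) := by
    intro z hz hzε z' hz' hz'ε
    have hd : 0 < z'.1 - z.1 := by linarith
    have hmem := hA hz hz' (a := (z'.1 - ε) / (z'.1 - z.1)) (b := (ε - z.1) / (z'.1 - z.1))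
      (div_nonneg (by linarith) hd.le) (div_nonneg (by linarith) hd.le)
      (by field_simp; ring)
    have := hM _ hmem (le_of_eq (by simp; field_simp; ring))
    simp only [Prod.snd_add, Prod.smul_snd, smul_eq_mul] at this
    rw [div_mul_eq_mul_div, div_mul_eq_mul_div, ← add_div, div_le_iff₀ hd] at this
    rw [div_le_div_iff₀ (by linarith) (by linarith)]
    linarith
  -- The multiplier is the supremum of the right-hand slopes; inserting `0` keeps it nonnegative.
  let R : Set ℝ := insert 0 ((fun z : ℝ × ℝ => (z.2 - M) / (z.1 - ε)) '' {z ∈ A | ε < z.1})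
  have hub : ∀ z ∈ A, z.1 < ε → ∀ r ∈ R, r ≤ (M - z.2) / (ε - z.1) := by
    rintro z hz hzε r (rfl | ⟨z', ⟨hz', hz'ε⟩, rfl⟩)
    · exact div_nonneg (by linarith [hM z hz hzε.le]) (by linarith)
    · exact key z hz hzε z' hz' hz'ε
  have hbdd : BddAbove R := ⟨_, fun r hr => hub z₀ hz₀ hz₀ε r hr⟩
  have h0 : (0 : ℝ) ∈ R := Set.mem_insert _ _
  refine ⟨sSup R, le_csSup hbdd h0, fun z hz => ?_⟩
  rcases lt_trichotomy z.1 ε with h | h | h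
  · have := csSup_le ⟨0, h0⟩ (hub z hz h)
    rw [le_div_iff₀ (by linarith)] at this
    linarith
  · rw [h, sub_self, mul_zero, add_zero]
    exact hM z hz h.le
  · have := le_csSup hbdd (Set.mem_insert_of_mem 0 ⟨z, ⟨hz, h⟩, rfl⟩ : _ ∈ R)
    rw [div_le_iff₀ (by linarith)] at this
    linarith

/-- If a separable sum is bounded by `B` on `S × ⋯ × S`, then its terms have upper bounds on `S`
whose sum is at most `B`. -/
theorem exists_sum_le_of_forall_sum_le {ι X : Type*} [Fintype ι] {S : Set X}
    {x₀ : ι → X} (hx₀ : ∀ i, x₀ i ∈ S) (g : ι → X → ℝ) {B : ℝ}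
    (h : ∀ x : ι → X, (∀ i, x i ∈ S) → ∑ i, g i (x i) ≤ B) :
    ∃ s : ι → ℝ, (∀ i, ∀ ξ ∈ S, g i ξ ≤ s i) ∧ ∑ i, s i ≤ B := by
  classical
  have hbdd : ∀ i, BddAbove (g i '' S) := fun i => by
    refine ⟨B - ∑ j ∈ Finset.univ.erase i, g j (x₀ j), ?_⟩
    rintro _ ⟨ξ, hξ, rfl⟩
    have := h (Function.update x₀ i ξ) (fun j => by
      by_cases hj : j = i
      · subst hj
        simpa using hξ
      · simpa [hj] using hx₀ j)
    rw [← Finset.add_sum_erase _ _ (Finset.mem_univ i), Function.update_self,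
      Finset.sum_congr rfl fun j hj => by
        rw [Function.update_of_ne (Finset.ne_of_mem_erase hj)]] at this
    linarith
  refine ⟨fun i => sSup (g i '' S), fun i ξ hξ => le_csSup (hbdd i) ⟨ξ, hξ, rfl⟩, ?_⟩
  refine le_of_forall_pos_le_add fun δ hδ => ?_
  -- The `+ 1` covers an empty index type.
  have hη : 0 < δ / (Fintype.card ι + 1) := by positivity
  have hex : ∀ i, ∃ ξ ∈ S, sSup (g i '' S) - δ / (Fintype.card ι + 1) < g i ξ := fun i => by
    obtain ⟨_, ⟨ξ, hξ, rfl⟩, hlt⟩ := exists_lt_of_lt_csSup (s := g i '' S) ⟨_, x₀ i, hx₀ i, rfl⟩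
      (sub_lt_self _ hη)
    exact ⟨ξ, hξ, hlt⟩
  choose x hx hlt using hex
  have h₁ := Finset.sum_le_sum fun i (_ : i ∈ Finset.univ) => (hlt i).le
  rw [Finset.sum_sub_distrib, Finset.sum_const, Finset.card_univ, nsmul_eq_mul] at h₁
  have h₂ : (Fintype.card ι : ℝ) * (δ / (Fintype.card ι + 1)) ≤ δ := by
    rw [mul_div_assoc', div_le_iff₀ (by positivity)]
    nlinarith
  linarith [h x hx]

/-- Strong duality: every upper bound of the worst-case expectation is witnessed by a dual feasible
pair `(t, s)`. -/
theorem exists_dual_of_worstCaseExpectation_le (hN : 1 ≤ N) (hL : 0 ≤ L)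
    (hf : ∀ ξ η, f ξ - f η ≤ L * p (ξ - η)) (hε : 0 ≤ ε) (hSm : MeasurableSet S)
    (hxi : ∀ i, xi i ∈ S) {M : ℝ}
    (hM : worstCaseExpectation p S xi ε (fun ξ => (f ξ : EReal)) ≤ M) :
    ∃ (t : ℝ) (s : Fin N → ℝ), 0 ≤ t ∧ (∀ i, ∀ ξ ∈ S, f ξ ≤ s i + t * p (ξ - xi i)) ∧
      t * ε + 1 / (N : ℝ) * ∑ i, s i ≤ M := by
  have hNpos : (0 : ℝ) < N := by exact_mod_cast hN
  have hA : ∀ z ∈ attainable p S xi f, z.1 ≤ ε → z.2 ≤ M := fun z hz hzε =>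
    EReal.coe_le_coe_iff.1
      ((le_worstCaseExpectation_of_mem_attainable hN hz hzε hSm
      (continuous_of_sub_le hf)).trans hM)
  have hbase := mem_attainable (p := p) (xi := xi) (f := f) hN hxi
  simp only [sub_self, map_zero, Finset.sum_const_zero, mul_zero] at hbase
  rcases hε.eq_or_lt with rfl | hε
  -- For `ε = 0` no pair has cost below `ε`, so `exists_multiplier` is unavailable; the Lipschitz
  -- constant serves as multiplier.
  · refine ⟨L, fun i => f (xi i), hL, fun i ξ _ => by linarith [hf ξ (xi i)], ?_⟩
    simpa using hA _ hbase le_rfl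
  · obtain ⟨t, ht, hA'⟩ := exists_multiplier convex_attainable hA hbase hε
    -- Discrete plans turn the multiplier inequality into a separable bound, which then splits into
    -- the `s i`.
    have hsum : ∀ x : Fin N → Fin m → ℝ, (∀ i, x i ∈ S) →
        ∑ i, (f (x i) - t * p (x i - xi i)) ≤ N * (M - t * ε) := fun x hx => by
      have := hA' _ (mem_attainable hN hx)
      simp only [one_div, inv_mul_eq_div] at this
      rw [Finset.sum_sub_distrib, ← Finset.mul_sum]
      have e₁ : (∑ i, f (x i)) = N * ((∑ i, f (x i)) / N) := by field_simp
      have e₂ : (∑ i, p (x i - xi i)) = N * ((∑ i, p (x i - xi i)) / N) := by field_simp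
      rw [e₁, e₂]
      nlinarith
    obtain ⟨s, hs, hsM⟩ := exists_sum_le_of_forall_sum_le hxi
      (fun i ξ => f ξ - t * p (ξ - xi i)) hsum
    refine ⟨t, s, ht, fun i ξ hξ => by linarith [hs i ξ hξ], ?_⟩
    rw [one_div, inv_mul_eq_div]
    have := (div_le_iff₀' hNpos).2 hsM
    linarith

end

/-! ### Linear programming duality and finite certificates -/

section

variable {m l n r : ℕ} {p : Seminorm ℝ (Fin m → ℝ)} {C : Matrix (Fin l) (Fin m) ℝ} {d : Fin l → ℝ}

theorem transpose_mulVec_dotProduct {a b : ℕ} (A : Matrix (Fin a) (Fin b) ℝ) (u : Fin a → ℝ)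
    (w : Fin b → ℝ) : (Aᵀ *ᵥ u) ⬝ᵥ w = u ⬝ᵥ (A *ᵥ w) := by
  rw [mulVec_transpose, dotProduct_mulVec]

theorem isClosed_polyhedron : IsClosed (polyhedron C d) :=
  isClosed_le (continuous_const.matrix_mulVec continuous_id) continuous_const

theorem convex_polyhedron : Convex ℝ (polyhedron C d) :=
  (convex_Iic d).linear_preimage C.mulVecLin

/-- Strong linear programming duality, attainment of the dual bound. -/
theorem exists_dual_feasible {W : Matrix (Fin r) (Fin n) ℝ} {g : Fin r → ℝ} {w : Fin n → ℝ}
    {δ : ℝ} {y₀ : Fin n → ℝ} (hy₀ : g ≤ W *ᵥ y₀) (h : ∀ y, g ≤ W *ᵥ y → δ ≤ y ⬝ᵥ w) :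
    ∃ θ ∈ dualFeasible w W, δ ≤ g ⬝ᵥ θ := by
  obtain ⟨θ, hθ, hw, hδ⟩ := affine_farkas (-W.mulVecLin) (-g) (-dotProductEquiv ℝ (Fin n) w) (-δ)
    (x₀ := y₀) (by simpa using hy₀) (fun y hy => by
      have := h y (by simpa using hy)
      rw [dotProduct_comm] at this
      simpa using this)
  refine ⟨θ, ⟨hθ, ?_⟩, ?_⟩
  · refine dotProduct_eq _ _ fun y => ?_
    have := hw y
    simp at this
    rw [transpose_mulVec_dotProduct, this]
  · rw [dotProduct_neg] at hδ
    rw [dotProduct_comm]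
    linarith

/-- Strong linear programming duality, attainment of the primal bound. -/
theorem exists_primal_feasible {W : Matrix (Fin r) (Fin n) ℝ} {g : Fin r → ℝ} {q : Fin n → ℝ}
    {δ : ℝ} {θ₀ : Fin r → ℝ} (hθ₀ : θ₀ ∈ dualFeasible q W)
    (h : ∀ θ ∈ dualFeasible q W, g ⬝ᵥ θ ≤ δ) : ∃ y, g ≤ W *ᵥ y ∧ q ⬝ᵥ y ≤ δ := by
  obtain ⟨ρ, y, hρ, hg, hδ⟩ := affine_farkas_eq (-LinearMap.id) (0 : Fin r → ℝ) Wᵀ.mulVecLin q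
    (dotProductEquiv ℝ (Fin r) g) δ (x₀ := θ₀) (by simpa using hθ₀.1)
    (by simpa [mulVec_transpose] using hθ₀.2)
    (fun θ h₁ h₂ => h θ ⟨by simpa using h₁, by simpa [mulVec_transpose] using h₂⟩)
  refine ⟨y, ?_, ?_⟩
  · have : g = W *ᵥ y - ρ := dotProduct_eq _ _ fun θ => by
      have := hg θ
      simp at this
      rw [this, sub_dotProduct, dotProduct_comm y, ← dotProduct_mulVec, dotProduct_comm θ]
      ring
    rw [this]
    exact sub_le_self _ hρ
  · rw [dotProduct_comm]
    simpa using hδ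

/-- Dual certificate for the domination of an affine function on a polyhedron. -/
theorem exists_affine_certificate (hp : ∀ ξ, p ξ = 0 → ξ = 0) {x₀ : Fin m → ℝ}
    (hx₀ : x₀ ∈ polyhedron C d) {t s b : ℝ} (ht : 0 ≤ t) {a : Fin m → ℝ}
    (h : ∀ ξ ∈ polyhedron C d, b + a ⬝ᵥ ξ ≤ s + t * p (ξ - x₀)) :
    ∃ γ : Fin l → ℝ, b + a ⬝ᵥ x₀ + γ ⬝ᵥ (d - C *ᵥ x₀) ≤ s ∧ dualNorm p (Cᵀ *ᵥ γ - a) ≤ t ∧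
      0 ≤ γ := by
  obtain ⟨c, e, hc, hc₀, hct⟩ := exists_affine_between (p := p) (S := polyhedron C d)
    (F := fun ξ => a ⬝ᵥ ξ + (b - s)) (x₀ := x₀)
    (((dotProductEquiv ℝ (Fin m) a).concaveOn convex_polyhedron).add_const _) hx₀ ht
    (fun ξ hξ => by linarith [h ξ hξ])
  obtain ⟨γ, hγ, hac, hd⟩ := affine_farkas C.mulVecLin d (dotProductEquiv ℝ (Fin m) (a - c))
    (e + s - b) (x₀ := x₀) hx₀ (fun ξ hξ => by
      have := hc ξ hξ
      simp
      linarith)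
  have hac' : ∀ ξ, (a - c) ⬝ᵥ ξ = γ ⬝ᵥ (C *ᵥ ξ) := hac
  refine ⟨γ, ?_, (dualNorm_le_iff hp).2 ⟨ht, fun ξ => ?_⟩, hγ⟩
  · rw [dotProduct_sub, ← hac', sub_dotProduct]
    linarith
  · rw [sub_dotProduct, transpose_mulVec_dotProduct, ← hac', sub_dotProduct]
    -- Here `Cᵀ *ᵥ γ - a = -c`, hence the reflected argument.
    have := hct (-ξ)
    rw [dotProduct_neg, map_neg_eq_map] at this
    linarith

/-- Dual certificate for the domination of a minimum of linear functions on a polyhedron. -/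
theorem exists_concave_certificate (hp : ∀ ξ, p ξ = 0 → ξ = 0) {Q : Matrix (Fin n) (Fin m) ℝ}
    {W : Matrix (Fin r) (Fin n) ℝ} {h : Fin r → ℝ} {y : (Fin m → ℝ) → Fin n → ℝ}
    (hy : ∀ ξ, h ≤ W *ᵥ y ξ) (hmin : ∀ ξ z, h ≤ W *ᵥ z → y ξ ⬝ᵥ (Q *ᵥ ξ) ≤ z ⬝ᵥ (Q *ᵥ ξ))
    {x₀ : Fin m → ℝ} (hx₀ : x₀ ∈ polyhedron C d) {t s : ℝ} (ht : 0 ≤ t)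
    (hs : ∀ ξ ∈ polyhedron C d, y ξ ⬝ᵥ (Q *ᵥ ξ) ≤ s + t * p (ξ - x₀)) :
    ∃ (γ : Fin l → ℝ) (z : Fin n → ℝ), z ⬝ᵥ (Q *ᵥ x₀) + γ ⬝ᵥ (d - C *ᵥ x₀) ≤ s ∧ h ≤ W *ᵥ z ∧
      dualNorm p (Qᵀ *ᵥ z - Cᵀ *ᵥ γ) ≤ t ∧ 0 ≤ γ := by
  obtain ⟨c, e, hc, hc₀, hct⟩ := exists_affine_between (p := p) (S := polyhedron C d)
    (F := fun ξ => y ξ ⬝ᵥ (Q *ᵥ ξ) - s) (x₀ := x₀) ⟨convex_polyhedron, by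
      -- Concavity: the minimizer at the convex combination is feasible at both endpoints.
      intro ξ _ η _ a b ha hb hab
      have h₁ := mul_le_mul_of_nonneg_left (hmin ξ _ (hy (a • ξ + b • η))) ha
      have h₂ := mul_le_mul_of_nonneg_left (hmin η _ (hy (a • ξ + b • η))) hb
      have hs : s = a * s + b * s := by rw [← add_mul, hab, one_mul]
      simp only [mulVec_add, mulVec_smul, dotProduct_add, dotProduct_smul, smul_eq_mul] at h₁ h₂ ⊢
      linarith⟩ hx₀ ht (fun ξ hξ => by linarith [hs ξ hξ])
  obtain ⟨θ₀, hθ₀, -⟩ := exists_dual_feasible (hy x₀) (hmin x₀)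
  -- Lift to pairs with `C *ᵥ ξ ≤ d`, `θ ≥ 0`, `Wᵀ *ᵥ θ = Q *ᵥ ξ`. There `h ⬝ᵥ θ` is at most the
  -- loss by weak LP duality, so `h ⬝ᵥ θ - c ⬝ᵥ ξ ≤ e + s`; the Farkas multiplier `z` of the
  -- equation is the required single recourse decision.
  let A : (Fin m → ℝ) × (Fin r → ℝ) →ₗ[ℝ] Fin l ⊕ Fin r → ℝ :=
    { toFun := fun x => Sum.elim (C *ᵥ x.1) (-x.2)
      map_add' := fun x x' => by
        ext (j | j) <;> simp [mulVec_add, add_comm]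
      map_smul' := fun a x => by
        ext (j | j) <;> simp [mulVec_smul] }
  obtain ⟨γ, z, hγ, hz, hδ⟩ := affine_farkas_eq A (Sum.elim d 0)
    (Wᵀ.mulVecLin ∘ₗ LinearMap.snd ℝ _ _ - Q.mulVecLin ∘ₗ LinearMap.fst ℝ _ _) 0
    (dotProductEquiv ℝ (Fin r) h ∘ₗ LinearMap.snd ℝ _ _
      - dotProductEquiv ℝ (Fin m) c ∘ₗ LinearMap.fst ℝ _ _) (e + s) (x₀ := (x₀, θ₀))
    (Sum.elim_le_elim_iff.2 ⟨hx₀, by simpa using hθ₀.1⟩)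
    (by simpa [sub_eq_zero, mulVec_transpose] using hθ₀.2)
    (by
      rintro ⟨ξ, θ⟩ h₁ h₂
      obtain ⟨hξ, hθ⟩ := Sum.elim_le_elim_iff.1 h₁
      have hθ : 0 ≤ θ := by simpa using hθ
      have hQ : Wᵀ *ᵥ θ = Q *ᵥ ξ := by simpa [sub_eq_zero, mulVec_transpose] using h₂
      have h₃ := hc ξ hξ
      have h₄ : h ⬝ᵥ θ ≤ y ξ ⬝ᵥ (Q *ᵥ ξ) := by
        rw [← hQ, dotProduct_comm (y ξ), transpose_mulVec_dotProduct, dotProduct_comm θ]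
        exact dotProduct_le_dotProduct_of_nonneg_right (hy ξ) hθ
      simp
      linarith)
  set γ₁ : Fin l → ℝ := fun j => γ (.inl j) with hγ₁
  set γ₂ : Fin r → ℝ := fun j => γ (.inr j) with hγ₂
  have hsplit : ∀ (u : Fin l → ℝ) (v : Fin r → ℝ),
      γ ⬝ᵥ Sum.elim u v = γ₁ ⬝ᵥ u + γ₂ ⬝ᵥ v := fun u v => by
    simp [dotProduct, hγ₁, hγ₂]
  have hz' : ∀ ξ θ, h ⬝ᵥ θ - c ⬝ᵥ ξ
      = γ₁ ⬝ᵥ (C *ᵥ ξ) - γ₂ ⬝ᵥ θ + ((W *ᵥ z) ⬝ᵥ θ - z ⬝ᵥ (Q *ᵥ ξ)) := fun ξ θ => by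
    have := hz (ξ, θ)
    simp only [A, LinearMap.sub_apply, LinearMap.comp_apply, LinearMap.snd_apply,
      LinearMap.fst_apply, dotProductEquiv_apply_apply, LinearMap.coe_mk, AddHom.coe_mk, hsplit,
      mulVecLin_apply, dotProduct_sub, dotProduct_neg] at this
    rw [this, dotProduct_comm z (Wᵀ *ᵥ θ), transpose_mulVec_dotProduct, dotProduct_comm θ]
    ring
  rw [hsplit, dotProduct_zero, dotProduct_zero, add_zero, add_zero] at hδ
  -- Comparing coefficients of `ξ` and of `θ` gives the gradient identity and the feasibility of
  -- `z`.
  have hc' : ∀ ξ, c ⬝ᵥ ξ = z ⬝ᵥ (Q *ᵥ ξ) - γ₁ ⬝ᵥ (C *ᵥ ξ) := fun ξ => by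
    have := hz' ξ 0
    simp only [dotProduct_zero] at this
    linarith
  have hh : h = W *ᵥ z - γ₂ := dotProduct_eq _ _ fun θ => by
    have := hz' 0 θ
    simp only [mulVec_zero, dotProduct_zero] at this
    rw [sub_dotProduct]
    linarith
  refine ⟨γ₁, z, ?_, ?_, (dualNorm_le_iff hp).2 ⟨ht, fun ξ => ?_⟩, fun j => hγ _⟩
  · have := hc' x₀
    rw [dotProduct_sub]
    linarith
  · rw [hh]
    exact sub_le_self _ fun j => hγ _
  · rw [sub_dotProduct, transpose_mulVec_dotProduct, transpose_mulVec_dotProduct, ← hc']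
    exact hct ξ

/-- A linear functional on a compact set is maximized at an extreme point. -/
theorem exists_extremePoint_isMaxOn {D : Set (Fin r → ℝ)} (hD : IsCompact D) (hne : D.Nonempty)
    (g : Fin r → ℝ) : ∃ v ∈ D.extremePoints ℝ, ∀ θ ∈ D, g ⬝ᵥ θ ≤ g ⬝ᵥ v := by
  let φ : (Fin r → ℝ) →L[ℝ] ℝ := (dotProductEquiv ℝ (Fin r) g).toContinuousLinearMap
  have hφ : ∀ θ, φ θ = g ⬝ᵥ θ := fun θ => rfl
  -- The maximizers form a compact exposed face; an extreme point of it (Krein-Milman) is extreme in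
  -- `D`.
  have hexp : IsExposed ℝ D (φ.toExposed D) := ContinuousLinearMap.toExposed.isExposed
  obtain ⟨θ, hθ, hmax⟩ := hD.exists_isMaxOn hne φ.continuous.continuousOn
  obtain ⟨v, hv⟩ := (hexp.isCompact hD).extremePoints_nonempty ⟨θ, hθ, fun y hy => hmax hy⟩
  refine ⟨v, hexp.isExtreme.extremePoints_subset_extremePoints hv, fun θ hθ => ?_⟩
  rw [← hφ, ← hφ]
  exact hv.1.2 θ hθ

/-! ### The two finite reformulations -/

theorem worstCaseExpectation_recourseObjective {N : ℕ} (hN : 1 ≤ N)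
    (hp : ∀ ξ, p ξ = 0 → ξ = 0) {xi : Fin N → Fin m → ℝ} (hxi : ∀ i, xi i ∈ polyhedron C d)
    {ε : ℝ} (hε : 0 ≤ ε) (Q : Matrix (Fin n) (Fin m) ℝ) (W : Matrix (Fin r) (Fin n) ℝ)
    (h : Fin r → ℝ) (hne : {y : Fin n → ℝ | h ≤ W *ᵥ y}.Nonempty)
    (hcomp : IsCompact {y : Fin n → ℝ | h ≤ W *ᵥ y}) :
    worstCaseExpectation p (polyhedron C d) xi ε (recourseObjective Q W h)
      = objectiveProgram p C d xi ε Q W h := by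
  have hex : ∀ ξ : Fin m → ℝ, ∃ y, h ≤ W *ᵥ y ∧
      ∀ z, h ≤ W *ᵥ z → y ⬝ᵥ (Q *ᵥ ξ) ≤ z ⬝ᵥ (Q *ᵥ ξ) := fun ξ => by
    obtain ⟨y, hy, hmin⟩ := hcomp.exists_isMinOn hne
      (continuous_id.dotProduct continuous_const : Continuous fun y => y ⬝ᵥ (Q *ᵥ ξ)).continuousOn
    exact ⟨y, hy, fun z hz => hmin hz⟩
  choose y hy hmin using hex
  obtain ⟨L, hL, hLp⟩ := exists_dotProduct_le_mul hp
    (hcomp.image (continuous_const.matrix_mulVec continuous_id : Continuous fun y => Qᵀ *ᵥ y))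
  have hlip : ∀ ξ η, y ξ ⬝ᵥ (Q *ᵥ ξ) - y η ⬝ᵥ (Q *ᵥ η) ≤ L * p (ξ - η) := fun ξ η => by
    have h₁ := hmin ξ (y η) (hy η)
    have h₂ := hLp _ ⟨y η, hy η, rfl⟩ (ξ - η)
    rw [transpose_mulVec_dotProduct, mulVec_sub, dotProduct_sub] at h₂
    linarith
  have hval : recourseObjective Q W h = fun ξ => ((y ξ ⬝ᵥ (Q *ᵥ ξ) : ℝ) : EReal) := by
    ext ξ
    exact le_antisymm (iInf₂_le (y ξ) (hy ξ))
      (le_iInf₂ fun z hz => EReal.coe_le_coe_iff.2 (hmin ξ z hz))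
  rw [hval]
  refine le_antisymm ?_ (EReal.le_of_forall_lt_iff_le.1 fun M hM => ?_)
  · simp only [objectiveProgram, le_iInf_iff]
    intro t s γ z hz
    -- Nonnegativity of the multiplier is implied by a dual norm constraint, available because `N ≥
    -- 1`.
    have ht : 0 ≤ t := ((dualNorm_le_iff hp).1 (hz ⟨0, hN⟩).2.2.1).1
    refine worstCaseExpectation_le hN hlip hε ht fun i ξ hξ => ?_
    obtain ⟨h₁, h₂, h₃, h₄⟩ := hz i
    have h₅ := ((dualNorm_le_iff hp).1 h₃).2 (ξ - xi i)
    have h₆ : γ i ⬝ᵥ (C *ᵥ ξ) ≤ γ i ⬝ᵥ d := dotProduct_le_dotProduct_of_nonneg_left hξ h₄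
    rw [sub_dotProduct, transpose_mulVec_dotProduct, transpose_mulVec_dotProduct, mulVec_sub,
      mulVec_sub, dotProduct_sub, dotProduct_sub] at h₅
    rw [dotProduct_sub] at h₁
    linarith [hmin ξ (z i) h₂]
  · obtain ⟨t, s, ht, hs, hsM⟩ := exists_dual_of_worstCaseExpectation_le hN hL hlip hε
      isClosed_polyhedron.measurableSet hxi hM.le
    choose γ z hz using fun i => exists_concave_certificate hp hy hmin (hxi i) ht (hs i)
    refine le_trans ?_ (EReal.coe_le_coe_iff.2 hsM)
    exact (iInf₂_le t s).trans ((iInf₂_le γ z).trans (iInf_le _ hz))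

theorem worstCaseExpectation_recourseRhs {N K : ℕ} (hN : 1 ≤ N)
    (hp : ∀ ξ, p ξ = 0 → ξ = 0) {xi : Fin N → Fin m → ℝ} (hxi : ∀ i, xi i ∈ polyhedron C d)
    {ε : ℝ} (hε : 0 ≤ ε) (q : Fin n → ℝ) (W : Matrix (Fin r) (Fin n) ℝ)
    (H : Matrix (Fin r) (Fin m) ℝ) (h : Fin r → ℝ) (v : Fin K → Fin r → ℝ)
    (hne : (dualFeasible q W).Nonempty) (hcomp : IsCompact (dualFeasible q W))
    (hv : Set.range v = (dualFeasible q W).extremePoints ℝ) :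
    worstCaseExpectation p (polyhedron C d) xi ε (recourseRhs q W H h)
      = rhsProgram p C d xi ε H h v := by
  have hvmem : ∀ k, v k ∈ dualFeasible q W := fun k =>
    extremePoints_subset (hv ▸ Set.mem_range_self k)
  have hex : ∀ ξ : Fin m → ℝ, ∃ k, ∀ θ ∈ dualFeasible q W,
      (H *ᵥ ξ + h) ⬝ᵥ θ ≤ (H *ᵥ ξ + h) ⬝ᵥ v k := fun ξ => by
    obtain ⟨w, hw, hmax⟩ := exists_extremePoint_isMaxOn hcomp hne (H *ᵥ ξ + h)
    rw [← hv] at hw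
    obtain ⟨k, rfl⟩ := hw
    exact ⟨k, hmax⟩
  choose k hk using hex
  have haff : ∀ ξ j, (H *ᵥ ξ + h) ⬝ᵥ v j = v j ⬝ᵥ h + (Hᵀ *ᵥ v j) ⬝ᵥ ξ := fun ξ j => by
    rw [transpose_mulVec_dotProduct, ← dotProduct_add, dotProduct_comm, add_comm]
  obtain ⟨L, hL, hLp⟩ := exists_dotProduct_le_mul hp
    (hcomp.image (continuous_const.matrix_mulVec continuous_id : Continuous fun θ => Hᵀ *ᵥ θ))
  have hlip : ∀ ξ η, (H *ᵥ ξ + h) ⬝ᵥ v (k ξ) - (H *ᵥ η + h) ⬝ᵥ v (k η) ≤ L * p (ξ - η) :=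
    fun ξ η => by
      have h₁ := hk η _ (hvmem (k ξ))
      have h₂ := hLp _ ⟨v (k ξ), hvmem (k ξ), rfl⟩ (ξ - η)
      rw [dotProduct_sub] at h₂
      linarith [haff ξ (k ξ), haff η (k ξ)]
  have hval : recourseRhs q W H h = fun ξ => (((H *ᵥ ξ + h) ⬝ᵥ v (k ξ) : ℝ) : EReal) := by
    ext ξ
    refine le_antisymm ?_ (le_iInf₂ fun y hy => EReal.coe_le_coe_iff.2 ?_)
    -- Primal feasibility is not assumed; it follows from the bound on the dual.
    · obtain ⟨y, hy, hle⟩ := exists_primal_feasible hne.some_mem (hk ξ)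
      exact (iInf₂_le y hy).trans (EReal.coe_le_coe_iff.2 hle)
    · rw [← (hvmem (k ξ)).2, transpose_mulVec_dotProduct, dotProduct_comm (v (k ξ))]
      exact dotProduct_le_dotProduct_of_nonneg_right hy (hvmem (k ξ)).1
  rw [hval]
  refine le_antisymm ?_ (EReal.le_of_forall_lt_iff_le.1 fun M hM => ?_)
  · simp only [rhsProgram, le_iInf_iff]
    intro t s γ hγ
    -- `k 0` is a maximizing vertex index at `ξ = 0`; it exhibits an element of `Fin K`.
    have ht : 0 ≤ t := ((dualNorm_le_iff hp).1 (hγ ⟨0, hN⟩ (k 0)).2.1).1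
    refine worstCaseExpectation_le hN hlip hε ht fun i ξ hξ => ?_
    obtain ⟨h₁, h₂, h₃⟩ := hγ i (k ξ)
    have h₄ := ((dualNorm_le_iff hp).1 h₂).2 (-(ξ - xi i))
    have h₅ : γ i (k ξ) ⬝ᵥ (C *ᵥ ξ) ≤ γ i (k ξ) ⬝ᵥ d :=
      dotProduct_le_dotProduct_of_nonneg_left hξ h₃
    rw [map_neg_eq_map, dotProduct_neg, sub_dotProduct, transpose_mulVec_dotProduct, mulVec_sub,
      dotProduct_sub, dotProduct_sub] at h₄
    rw [dotProduct_sub] at h₁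
    linarith [haff ξ (k ξ)]
  · obtain ⟨t, s, ht, hs, hsM⟩ := exists_dual_of_worstCaseExpectation_le hN hL hlip hε
      isClosed_polyhedron.measurableSet hxi hM.le
    have hcert : ∀ i j, ∀ ξ ∈ polyhedron C d,
        v j ⬝ᵥ h + (Hᵀ *ᵥ v j) ⬝ᵥ ξ ≤ s i + t * p (ξ - xi i) := fun i j ξ hξ => by
      rw [← haff]
      exact (hk ξ _ (hvmem j)).trans (hs i ξ hξ)
    choose γ hγ using fun i j => exists_affine_certificate hp (hxi i) ht (hcert i j)
    refine le_trans ?_ (EReal.coe_le_coe_iff.2 hsM)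
    exact (iInf₂_le t s).trans (iInf₂_le γ hγ)

end

end WassersteinDRO

theorem mainTheorem8 {m l N : ℕ} (hN : 1 ≤ N)
    (p : Seminorm ℝ (Fin m → ℝ)) (hp : ∀ ξ, p ξ = 0 → ξ = 0)
    (C : Matrix (Fin l) (Fin m) ℝ) (d : Fin l → ℝ)
    (xi : Fin N → Fin m → ℝ) (hxi : ∀ i, xi i ∈ WassersteinDRO.polyhedron C d)
    (ε : ℝ) (hε : 0 ≤ ε) :
    (∀ (n r : ℕ) (Q : Matrix (Fin n) (Fin m) ℝ) (W : Matrix (Fin r) (Fin n) ℝ) (h : Fin r → ℝ),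
      {y : Fin n → ℝ | h ≤ W *ᵥ y}.Nonempty →
      IsCompact {y : Fin n → ℝ | h ≤ W *ᵥ y} →
      WassersteinDRO.worstCaseExpectation p (WassersteinDRO.polyhedron C d) xi ε
          (WassersteinDRO.recourseObjective Q W h)
        = WassersteinDRO.objectiveProgram p C d xi ε Q W h) ∧
    (∀ (n r K : ℕ) (q : Fin n → ℝ) (W : Matrix (Fin r) (Fin n) ℝ) (H : Matrix (Fin r) (Fin m) ℝ)
      (h : Fin r → ℝ) (v : Fin K → Fin r → ℝ),
      (WassersteinDRO.dualFeasible q W).Nonempty →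
      IsCompact (WassersteinDRO.dualFeasible q W) →
      Set.range v = (WassersteinDRO.dualFeasible q W).extremePoints ℝ →
      WassersteinDRO.worstCaseExpectation p (WassersteinDRO.polyhedron C d) xi ε
          (WassersteinDRO.recourseRhs q W H h)
        = WassersteinDRO.rhsProgram p C d xi ε H h v) := by
  exact ⟨fun _ _ Q W h hne hcomp =>
      WassersteinDRO.worstCaseExpectation_recourseObjective hN hp hxi hε Q W h hne hcomp,
    fun _ _ _ q W H h v hne hcomp hv =>
      WassersteinDRO.worstCaseExpectation_recourseRhs hN hp hxi hε q W H h v hne hcomp hv⟩
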